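/- For integers $0\le \ell\le m$ let $d_\ell(m)$ be the coefficient of $x^\ell$ in the Boros--Moll polynomial $$P_m(x)=2^{-2m}\sum_{k=0}^m 2^k \binom{2m-2k}{m-k}\binom{m+k}{k}(x+1)^k ,$$ that is, $$d_\ell(m)=2^{-2m}\sum_{k=\ell}^m 2^k\binom{2m-2k}{m-k}\binom{m+k}{k}\binom{k}{\ell}.$$ Then for all integers $\ell\ge 1$ and $m\ge \ell+1$, $$d_\ell(m)^2 > d_\ell(m-1)\,d_\ell(m+1) > d_{\ell-1}(m)\,d_{\ell+1}(m).$$ -/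

import Mathlib

open Finset Polynomial

/-- The Boros-Moll polynomial
`P_m(x) = 2^(-2m) * ∑_{k=0}^m 2^k * C(2m-2k, m-k) * C(m+k, k) * (x+1)^k`. -/
noncomputable def borosMollPoly (m : ℕ) : ℝ[X] :=
  C (((2 : ℝ) ^ (2 * m))⁻¹) * ∑ k ∈ range (m + 1),
    C ((2 : ℝ) ^ k * ((2 * m - 2 * k).choose (m - k) : ℝ) * ((m + k).choose k : ℝ)) *
      (X + 1) ^ k

/-- `borosMoll l m` is `d_l(m)`, the coefficient of `x^l` in the Boros-Moll polynomial `P_m(x)`. -/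
noncomputable def borosMoll (l m : ℕ) : ℝ := (borosMollPoly m).coeff l

/-- The explicit formula
`d_l(m) = 2^(-2m) * ∑_{k=l}^m 2^k * C(2m-2k, m-k) * C(m+k, k) * C(k, l)`. -/
theorem borosMoll_eq_sum (l m : ℕ) :
    borosMoll l m = ((2 : ℝ) ^ (2 * m))⁻¹ * ∑ k ∈ Icc l m,
      (2 : ℝ) ^ k * ((2 * m - 2 * k).choose (m - k) : ℝ) * ((m + k).choose k : ℝ) *
        (k.choose l : ℝ) := by
  unfold borosMoll borosMollPoly
  rw [coeff_C_mul, finsetSum_coeff]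
  congr 1
  simp only [coeff_C_mul, coeff_X_add_one_pow]
  symm
  apply sum_subset
  · intro k hk
    simp only [mem_Icc, mem_range] at hk ⊢
    omega
  · intro k hk hk'
    simp only [mem_Icc, mem_range] at hk hk'
    rw [Nat.choose_eq_zero_of_lt (by omega : k < l)]
    simp

/-!
Write `P_m(x) = Q_m(x + 1)`. The coefficients of `Q_m` are hypergeometric, and comparing
neighbouring ones shows that `Q_m` satisfies a second order differential equation and a first order
differential recurrence in `m`. Transported to `P_m` and read off coefficientwise, they become

* `l (2m + 1) d_l(m) = (m + 1 - l) (m + l) d_{l-1}(m) + l (l + 1) d_{l+1}(m)`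
  (`borosMoll_recurrence_index`),
* `2 (m + 1) d_l(m + 1) = 2 (m + l) d_{l-1}(m) + (4m + 2l + 3) d_l(m)`
  (`borosMoll_recurrence_degree`).

Eliminating, `d_l(m - 1)`, `d_{l-1}(m)` and `d_{l+1}(m)` are all linear combinations of
`d_l(m)` and `d_l(m + 1)`, so each of the two inequalities says that an explicit quadratic form in
`(d_l(m), d_l(m + 1))` is positive. Both are positive as soon as `d_l(m + 1) / d_l(m)` is at least
`(4m² + 7m + l + 3) / (2 (m + 1) (m + 1 - l))`, and this lower bound (`borosMoll_ratio_lower_bound`)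
follows by induction on `m` from the three-term recurrence in `m`, with equality at `m = l`.
-/

/-! ### The coefficients in powers of `x + 1` -/

/-- The coefficient of `(x + 1) ^ k` in the Boros-Moll polynomial `P_m`; it is `0` for `k > m`. -/
noncomputable def shiftedCoeff (m k : ℕ) : ℝ :=
  if k ≤ m then (4 ^ m)⁻¹ * (2 ^ k * ((m - k).centralBinom : ℝ) * ((m + k).choose k : ℝ)) else 0

lemma shiftedCoeff_add (n k : ℕ) :
    shiftedCoeff (n + k) k =
      (4 ^ (n + k))⁻¹ * (2 ^ k * (n.centralBinom : ℝ) * ((n + k + k).choose k : ℝ)) := by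
  simp [shiftedCoeff]

lemma shiftedCoeff_of_lt {m k : ℕ} (h : m < k) : shiftedCoeff m k = 0 :=
  if_neg (by omega)

lemma choose_succ_succ_mul (n k : ℕ) :
    ((n : ℝ) + 2 * k + 2) * (n + (k + 1) + k).choose k =
      (n + (k + 1) + (k + 1)).choose (k + 1) * (k + 1) := by
  have := Nat.add_one_mul_choose_eq (n + (k + 1) + k) k
  rw [← add_assoc (n + (k + 1)) k 1]
  rw [← @Nat.cast_inj ℝ] at this
  push_cast at this ⊢
  linear_combination this

lemma shiftedCoeff_succ_right (m k : ℕ) :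
    ((k : ℝ) + 1) * (2 * m - 1 - 2 * k) * shiftedCoeff m (k + 1) =
      (m - k) * (m + k + 1) * shiftedCoeff m k := by
  rcases lt_trichotomy m k with h | rfl | h
  · rw [shiftedCoeff_of_lt h, shiftedCoeff_of_lt (by omega)]; simp
  · rw [shiftedCoeff_of_lt (Nat.lt_succ_self m)]; simp
  · obtain ⟨n, rfl⟩ : ∃ n, m = n + (k + 1) := ⟨m - (k + 1), by omega⟩
    have h1 := shiftedCoeff_add (n + 1) k
    rw [show n + 1 + k = n + (k + 1) by ring] at h1
    rw [shiftedCoeff_add, h1]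
    have hc : ((n : ℝ) + 1) * (n + 1).centralBinom = 2 * (2 * n + 1) * n.centralBinom := by
      exact_mod_cast Nat.succ_mul_centralBinom_succ n
    have hb := choose_succ_succ_mul n k
    push_cast
    rw [pow_succ (2 : ℝ) k]
    linear_combination (-(4 ^ (n + (k + 1)) : ℝ)⁻¹ * 2 ^ k * 2 * (2 * n + 1) * n.centralBinom) * hb
      - (4 ^ (n + (k + 1)) : ℝ)⁻¹ * 2 ^ k * (n + (k + 1) + k).choose k * (n + 2 * k + 2) * hc

lemma shiftedCoeff_succ_succ (m k : ℕ) :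
    2 * ((m : ℝ) + 1) * (k + 1) * shiftedCoeff (m + 1) (k + 1) =
      (m + k + 1) * (m + k + 2) * shiftedCoeff m k := by
  rcases lt_or_ge m k with h | h
  · rw [shiftedCoeff_of_lt h, shiftedCoeff_of_lt (by omega)]; simp
  · obtain ⟨n, rfl⟩ : ∃ n, m = n + k := ⟨m - k, by omega⟩
    rw [shiftedCoeff_add, show n + k + 1 = n + (k + 1) by ring, shiftedCoeff_add]
    have hb := choose_succ_succ_mul n k
    have ha : ((n + k + k).choose k : ℝ) * (n + 2 * k + 1) =
        (n + (k + 1) + k).choose k * (n + k + 1) := by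
      have := Nat.choose_mul_succ_eq (n + k + k) k
      rw [show n + k + k + 1 - k = n + k + 1 by omega,
        show n + k + k + 1 = n + (k + 1) + k by ring, ← @Nat.cast_inj ℝ] at this
      push_cast at this
      linear_combination this
    have h4 : ((4 : ℝ) ^ (n + (k + 1)))⁻¹ = (4 ^ (n + k))⁻¹ * 4⁻¹ := by
      rw [← mul_inv, ← pow_succ, add_assoc]
    rw [h4, pow_succ (2 : ℝ) k]
    push_cast
    linear_combination (-(4 ^ (n + k) : ℝ)⁻¹ * 2 ^ k * n.centralBinom * (n + k + 1)) * hb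
      - (4 ^ (n + k) : ℝ)⁻¹ * 2 ^ k * n.centralBinom * (n + 2 * k + 2) * ha

lemma shiftedCoeff_succ_zero (m : ℕ) :
    2 * ((m : ℝ) + 1) * shiftedCoeff (m + 1) 0 = (2 * m + 1) * shiftedCoeff m 0 := by
  have hc : ((m : ℝ) + 1) * (m + 1).centralBinom = 2 * (2 * m + 1) * m.centralBinom := by
    exact_mod_cast Nat.succ_mul_centralBinom_succ m
  have h4 : ((4 : ℝ) ^ (m + 1))⁻¹ = (4 ^ m)⁻¹ * 4⁻¹ := by rw [← mul_inv, ← pow_succ]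
  simp only [shiftedCoeff, Nat.zero_le, if_true, Nat.sub_zero, pow_zero, Nat.choose_zero_right,
    Nat.cast_one, h4]
  linear_combination (4 ^ m : ℝ)⁻¹ * 2⁻¹ * hc

lemma shiftedCoeff_succ_left (m k : ℕ) :
    2 * ((m : ℝ) + 1) * shiftedCoeff (m + 1) (k + 1) =
      2 * (m + k + 1) * shiftedCoeff m k + (2 * m - 1 - 2 * k) * shiftedCoeff m (k + 1) := by
  have hk : (k : ℝ) + 1 ≠ 0 := by positivity
  apply mul_left_cancel₀ hk
  linear_combination shiftedCoeff_succ_succ m k - shiftedCoeff_succ_right m k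

/-! ### Differential equations -/

/-- The polynomial `Q_m` with `P_m(x) = Q_m(x + 1)`. -/
noncomputable def shiftedPoly (m : ℕ) : ℝ[X] :=
  ∑ k ∈ range (m + 1), C (shiftedCoeff m k) * X ^ k

lemma coeff_shiftedPoly (m k : ℕ) : (shiftedPoly m).coeff k = shiftedCoeff m k := by
  simp only [shiftedPoly, finsetSum_coeff, coeff_C_mul, coeff_X_pow, mul_ite, mul_one, mul_zero,
    Finset.sum_ite_eq, mem_range]
  split_ifs with h
  · rfl
  · rw [shiftedCoeff_of_lt (by omega)]

lemma borosMollPoly_eq_comp (m : ℕ) : borosMollPoly m = (shiftedPoly m).comp (X + 1) := by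
  rw [borosMollPoly, shiftedPoly, Polynomial.sum_comp, Finset.mul_sum]
  refine Finset.sum_congr rfl fun k hk => ?_
  have hk' : k ≤ m := by simpa [Nat.lt_succ_iff] using hk
  rw [mul_comp, C_comp, pow_comp, X_comp, ← mul_assoc, ← C_mul, shiftedCoeff, if_pos hk',
    pow_mul, Nat.centralBinom, Nat.mul_sub]
  norm_num

lemma coeff_X_mul_derivative (p : ℝ[X]) (k : ℕ) :
    (X * derivative p).coeff k = k * p.coeff k := by
  cases k with
  | zero => simp
  | succ k => rw [coeff_X_mul, coeff_derivative]; push_cast; ring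

lemma coeff_X_mul_derivative_derivative (p : ℝ[X]) (k : ℕ) :
    (X * derivative (derivative p)).coeff k = (k + 1) * k * p.coeff (k + 1) := by
  rw [coeff_X_mul_derivative, coeff_derivative]; ring

lemma coeff_X_sq_mul_derivative_derivative (p : ℝ[X]) (k : ℕ) :
    (X * (X * derivative (derivative p))).coeff k = k * (k - 1) * p.coeff k := by
  cases k with
  | zero => simp
  | succ k =>
    rw [coeff_X_mul, coeff_X_mul_derivative_derivative]; push_cast; ring

/-- The differential equation `(2y - y²) Q'' - (2m - 1 + 2y) Q' + m (m + 1) Q = 0` for `Q = Q_m`,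
equivalent to the two-term recurrence `shiftedCoeff_succ_right`. -/
lemma shiftedPoly_ode (m : ℕ) :
    C 2 * (X * derivative (derivative (shiftedPoly m)))
      - X * (X * derivative (derivative (shiftedPoly m)))
      - C (2 * (m : ℝ) - 1) * derivative (shiftedPoly m)
      - C 2 * (X * derivative (shiftedPoly m))
      + C ((m : ℝ) * (m + 1)) * shiftedPoly m = 0 := by
  ext k
  simp only [coeff_add, coeff_sub, coeff_C_mul, coeff_X_mul_derivative,
    coeff_X_sq_mul_derivative_derivative, coeff_derivative, coeff_shiftedPoly, coeff_zero]
  linear_combination -shiftedCoeff_succ_right m k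

lemma shiftedPoly_succ (m : ℕ) :
    C (2 * ((m : ℝ) + 1)) * shiftedPoly (m + 1) =
      C (2 * ((m : ℝ) + 1)) * (X * shiftedPoly m) + C (2 * (m : ℝ) + 1) * shiftedPoly m
        + C 2 * (X * (X * derivative (shiftedPoly m))) - C 2 * (X * derivative (shiftedPoly m)) := by
  ext k
  cases k with
  | zero =>
    simp only [coeff_add, coeff_sub, coeff_C_mul, coeff_X_mul_zero, coeff_shiftedPoly]
    linear_combination shiftedCoeff_succ_zero m
  | succ k =>
    simp only [coeff_add, coeff_sub, coeff_C_mul, coeff_X_mul, coeff_X_mul_derivative,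
      coeff_derivative, coeff_shiftedPoly]
    linear_combination shiftedCoeff_succ_left m k

lemma derivative_comp_X_add_one (p : ℝ[X]) :
    derivative (p.comp (X + 1)) = (derivative p).comp (X + 1) := by
  simp [derivative_comp]

/-- The differential equation `(1 - x²) P'' - (2m + 1 + 2x) P' + m (m + 1) P = 0` for `P = P_m`,
obtained from the one for `Q_m` by substituting `y = x + 1`. -/
lemma borosMollPoly_ode (m : ℕ) :
    derivative (derivative (borosMollPoly m)) - X * (X * derivative (derivative (borosMollPoly m)))
      - C (2 * (m : ℝ) + 1) * derivative (borosMollPoly m)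
      - C 2 * (X * derivative (borosMollPoly m))
      + C ((m : ℝ) * (m + 1)) * borosMollPoly m = 0 := by
  have h := congrArg (fun p : ℝ[X] => p.comp (X + 1)) (shiftedPoly_ode m)
  simp only [add_comp, sub_comp, mul_comp, C_comp, X_comp, zero_comp,
    ← derivative_comp_X_add_one, ← borosMollPoly_eq_comp] at h
  simp only [C_add, C_sub, C_mul, C_1, C_ofNat] at h ⊢
  linear_combination h

lemma borosMollPoly_succ (m : ℕ) :
    C (2 * ((m : ℝ) + 1)) * borosMollPoly (m + 1) =
      C (2 * ((m : ℝ) + 1)) * (X * borosMollPoly m) + C (4 * (m : ℝ) + 3) * borosMollPoly m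
        + C 2 * (X * (X * derivative (borosMollPoly m)))
        + C 2 * (X * derivative (borosMollPoly m)) := by
  have h := congrArg (fun p : ℝ[X] => p.comp (X + 1)) (shiftedPoly_succ m)
  simp only [add_comp, sub_comp, mul_comp, C_comp, X_comp,
    ← derivative_comp_X_add_one, ← borosMollPoly_eq_comp] at h
  simp only [C_add, C_mul, C_1, C_ofNat] at h ⊢
  linear_combination h

/-! ### Recurrences for the Boros-Moll coefficients -/

lemma coeff_borosMollPoly (l m : ℕ) : (borosMollPoly m).coeff l = borosMoll l m := rfl

lemma borosMoll_recurrence_index (l m : ℕ) :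
    ((l : ℝ) + 1) * (2 * m + 1) * borosMoll (l + 1) m =
      (m - l) * (m + l + 1) * borosMoll l m + (l + 1) * (l + 2) * borosMoll (l + 2) m := by
  have h := congrArg (fun p : ℝ[X] => p.coeff l) (borosMollPoly_ode m)
  simp only [coeff_add, coeff_sub, coeff_C_mul, coeff_X_mul_derivative,
    coeff_X_sq_mul_derivative_derivative, coeff_derivative, coeff_zero, coeff_borosMollPoly] at h
  push_cast at h
  linear_combination -h

lemma borosMoll_recurrence_degree (l m : ℕ) :
    2 * ((m : ℝ) + 1) * borosMoll (l + 1) (m + 1) =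
      2 * (m + l + 1) * borosMoll l m + (4 * m + 2 * l + 5) * borosMoll (l + 1) m := by
  have h := congrArg (fun p : ℝ[X] => p.coeff (l + 1)) (borosMollPoly_succ m)
  simp only [coeff_add, coeff_C_mul, coeff_X_mul, coeff_X_mul_derivative,
    coeff_derivative, coeff_borosMollPoly] at h
  linear_combination h

/-- Eliminates `d_{l-1}(m)` from the two basic recurrences (here with `l + 1` in place of `l`), so
that `d_{l+1}(m)` is expressed through `d_l(m)` and `d_l(m + 1)`. -/
lemma borosMoll_recurrence_upper (l m : ℕ) :
    2 * ((m : ℝ) + 1) * (m - l) * borosMoll (l + 1) (m + 1) =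
      (4 * m - 2 * l + 1) * (m + l + 2) * borosMoll (l + 1) m
        - 2 * (l + 1) * (l + 2) * borosMoll (l + 2) m := by
  linear_combination ((m : ℝ) - l) * borosMoll_recurrence_degree l m
    - 2 * borosMoll_recurrence_index l m

/-- The recurrence in the degree alone (for the index `l + 1`), which expresses `d_l(m - 1)` through
`d_l(m)` and `d_l(m + 1)` and drives the induction for the ratio bound. -/
lemma borosMoll_recurrence_three_term (l m : ℕ) :
    4 * ((m : ℝ) + 1 - l) * (m + 1) * (m + 2) * borosMoll (l + 1) (m + 2) =
      2 * (m + 1) * (8 * m ^ 2 + 24 * m + 19 - 4 * (l + 1) ^ 2) * borosMoll (l + 1) (m + 1)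
        - (m + l + 2) * (4 * m + 3) * (4 * m + 5) * borosMoll (l + 1) m := by
  have h1 := borosMoll_recurrence_upper l (m + 1)
  have h2 := borosMoll_recurrence_degree (l + 1) m
  have h3 := borosMoll_recurrence_upper l m
  push_cast at h1 h2
  linear_combination (2 * ((m : ℝ) + 1)) * h1 - 2 * ((l : ℝ) + 1) * (l + 2) * h2
    - (4 * (m : ℝ) + 2 * l + 7) * h3

lemma borosMoll_pos {l m : ℕ} (h : l ≤ m) : 0 < borosMoll l m := by
  rw [borosMoll_eq_sum]
  refine mul_pos (by positivity) (Finset.sum_pos (fun k hk => ?_) ⟨m, by simp [h]⟩)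
  rw [mem_Icc] at hk
  have h1 : 0 < (2 * m - 2 * k).choose (m - k) := Nat.choose_pos (by omega)
  have h2 : 0 < (m + k).choose k := Nat.choose_pos (by omega)
  have h3 : 0 < k.choose l := Nat.choose_pos hk.1
  positivity

lemma borosMoll_of_lt {l m : ℕ} (h : m < l) : borosMoll l m = 0 := by
  rw [borosMoll_eq_sum, Icc_eq_empty (by omega)]; simp

/-! ### The lower bound for the ratio `d_l(m + 1) / d_l(m)` -/

/-- The ratio bound for the index `l + 1` and the degree `m = l + 1 + j`; it is an equality for
`j = 0`. -/
lemma borosMoll_ratio_lower_bound (l j : ℕ) {m : ℕ} (hm : m = l + 1 + j) :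
    (4 * (m : ℝ) ^ 2 + 7 * m + l + 4) * borosMoll (l + 1) m ≤
      2 * (m - l) * (m + 1) * borosMoll (l + 1) (m + 1) := by
  induction j generalizing m with
  | zero =>
    have h := borosMoll_recurrence_upper l m
    -- For `m = l + 1` the term `d_{l+2}(m)` vanishes and the recurrence is the claimed equality.
    rw [borosMoll_of_lt (by omega : m < l + 2)] at h
    subst hm
    push_cast at h ⊢
    linear_combination -h
  | succ j ih =>
    obtain ⟨n, rfl⟩ : ∃ n, m = n + 1 := ⟨m - 1, by omega⟩
    have hn : n = l + 1 + j := by omega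
    have ih := ih hn
    have h3 := borosMoll_recurrence_three_term l n
    have hb : 0 < borosMoll (l + 1) (n + 1) := borosMoll_pos (by omega)
    generalize borosMoll (l + 1) (n + 1) = b at *
    generalize borosMoll (l + 1) n = a at *
    change _ ≤ 2 * (((n + 1 : ℕ) : ℝ) - l) * (((n + 1 : ℕ) : ℝ) + 1) * borosMoll (l + 1) (n + 2)
    generalize borosMoll (l + 1) (n + 2) = c at *
    have hK : (0 : ℝ) ≤ (n + l + 2) * (4 * n + 3) * (4 * n + 5) := by positivity
    -- By the three-term recurrence, replacing `a` by its upper bound in terms of `b` leaves an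
    -- inequality between polynomials in `n` and `l`.
    have hpoly : ((n : ℝ) + l + 2) * (4 * n + 3) * (4 * n + 5) * (2 * (n - l) * (n + 1)) ≤
        (4 * n ^ 2 + 7 * n + l + 4) * (2 * (n + 1) * (8 * n ^ 2 + 24 * n + 19 - 4 * (l + 1) ^ 2)
          - 2 * (n + 1) * (4 * (n + 1) ^ 2 + 7 * (n + 1) + l + 4)) := by
      -- In terms of `l` and `j` the difference has nonnegative coefficients.
      rw [← sub_nonneg, hn]
      push_cast
      ring_nf
      positivity
    have hc : (0 : ℝ) < 2 * (n + 1) * (4 * n ^ 2 + 7 * n + l + 4) := by positivity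
    push_cast
    rw [← mul_le_mul_iff_right₀ hc]
    have h1 := mul_le_mul_of_nonneg_left ih hK
    have h2 := mul_le_mul_of_nonneg_right hpoly hb.le
    linear_combination h1 + h2 - (4 * (n : ℝ) ^ 2 + 7 * n + l + 4) * h3

/-! ### The two quadratic forms -/

lemma quadratic_form_pos {P Q R a u : ℝ} (hP : 0 < P) (hQ : 0 ≤ Q) (hR : 0 ≤ R) (ha : 0 < a)
    (hu : 0 ≤ u) : 0 < P * a ^ 2 + Q * (a * u) + R * u ^ 2 := by
  positivity

/-- The first inequality for the index `l + 1` and the degree `n + 1`. With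
`a = d_{l+1}(n + 1)`, `b = d_{l+1}(n + 2)` and the ratio bound `u = D b - T a ≥ 0`, the difference of
the two sides is, up to a positive factor, a quadratic form in `a` and `u` with nonnegative
coefficients. -/
lemma borosMoll_sq_gt (l j : ℕ) {n : ℕ} (hn : n = l + 1 + j) :
    borosMoll (l + 1) n * borosMoll (l + 1) (n + 2) < borosMoll (l + 1) (n + 1) ^ 2 := by
  have h3 := borosMoll_recurrence_three_term l n
  have hr := borosMoll_ratio_lower_bound l (j + 1) (m := n + 1) (by omega)
  have ha : 0 < borosMoll (l + 1) (n + 1) := borosMoll_pos (by omega)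
  change _ ≤ _ * borosMoll (l + 1) (n + 2) at hr
  generalize borosMoll (l + 1) n = c at *
  generalize borosMoll (l + 1) (n + 1) = a at *
  generalize borosMoll (l + 1) (n + 2) = b at *
  push_cast at hr
  obtain ⟨T, hT⟩ : ∃ T : ℝ, T = 4 * (n + 1) ^ 2 + 7 * (n + 1) + l + 4 := ⟨_, rfl⟩
  obtain ⟨D, hD⟩ : ∃ D : ℝ, D = 2 * (n + 1 - l) * (n + 1 + 1) := ⟨_, rfl⟩
  obtain ⟨K, hK⟩ : ∃ K : ℝ, K = (n + l + 2) * (4 * n + 3) * (4 * n + 5) := ⟨_, rfl⟩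
  obtain ⟨R, hR⟩ : ∃ R : ℝ,
    R = 2 * (n + 1) * (8 * n ^ 2 + 24 * n + 19 - 4 * (l + 1) ^ 2) := ⟨_, rfl⟩
  -- After the substitution `n = l + 1 + j`, all the polynomials in `l` and `j` below have
  -- nonnegative coefficients.
  have hD0 : 0 < D := by
    rw [hD, hn]; push_cast; ring_nf; positivity
  have hK0 : 0 < K := by rw [hK]; positivity
  have hP : 0 < K * D - R * T + 2 * (n + 1) * T ^ 2 := by
    rw [hK, hD, hR, hT, hn]; push_cast; ring_nf; positivity
  have hQ : 0 ≤ 4 * (n + 1) * T - R := by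
    rw [hR, hT, hn]; push_cast; ring_nf; positivity
  have hS : (0 : ℝ) ≤ 2 * (n + 1) := by positivity
  rw [← hT, ← hD, ← sub_nonneg] at hr
  have hform := quadratic_form_pos hP hQ hS ha hr
  have hrec : K * c = R * a - 2 * (n + 1) * (D * b) := by
    rw [hK, hR, hD]; linear_combination h3
  rw [← sub_pos]
  -- Multiplying by `K` turns `c` into a combination of `a` and `b`; the factor `D` turns `b`
  -- into `(T a + u) / D` without leaving a denominator.
  refine pos_of_mul_pos_right (a := K * D) ?_ (by positivity)
  linear_combination hform + D * b * hrec

/-- The second inequality for the index `l + 1` and the degree `n + 1`, by the same reduction to a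
quadratic form in `a = d_{l+1}(n + 1)` and the defect `u = D b - T a` in the ratio bound. -/
lemma borosMoll_mul_gt (l j : ℕ) {n : ℕ} (hn : n = l + 1 + j) :
    borosMoll l (n + 1) * borosMoll (l + 2) (n + 1) <
      borosMoll (l + 1) n * borosMoll (l + 1) (n + 2) := by
  have h3 := borosMoll_recurrence_three_term l n
  have he := borosMoll_recurrence_degree l (n + 1)
  have hf := borosMoll_recurrence_upper l (n + 1)
  have hr := borosMoll_ratio_lower_bound l (j + 1) (m := n + 1) (by omega)
  have ha : 0 < borosMoll (l + 1) (n + 1) := borosMoll_pos (by omega)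
  change _ ≤ _ * borosMoll (l + 1) (n + 2) at hr
  change _ * borosMoll (l + 1) (n + 2) = _ at he
  change _ * borosMoll (l + 1) (n + 2) = _ at hf
  generalize borosMoll (l + 1) n = c at *
  generalize borosMoll (l + 1) (n + 1) = a at *
  generalize borosMoll (l + 1) (n + 2) = b at *
  generalize borosMoll l (n + 1) = e at *
  generalize borosMoll (l + 2) (n + 1) = f at *
  push_cast at hr he hf
  obtain ⟨T, hT⟩ : ∃ T : ℝ, T = 4 * (n + 1) ^ 2 + 7 * (n + 1) + l + 4 := ⟨_, rfl⟩
  obtain ⟨D, hD⟩ : ∃ D : ℝ, D = 2 * (n + 1 - l) * (n + 1 + 1) := ⟨_, rfl⟩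
  obtain ⟨W, hW⟩ : ∃ W : ℝ, W = (4 * n + 3) * (4 * n + 5) := ⟨_, rfl⟩
  obtain ⟨R, hR⟩ : ∃ R : ℝ,
    R = 2 * (n + 1) * (8 * n ^ 2 + 24 * n + 19 - 4 * (l + 1) ^ 2) := ⟨_, rfl⟩
  obtain ⟨E, hE⟩ : ∃ E : ℝ, E = 4 * (n + 1) + 2 * l + 5 := ⟨_, rfl⟩
  obtain ⟨G, hG⟩ : ∃ G : ℝ, G = (4 * (n + 1) - 2 * l + 1) * (n + 1 + l + 2) := ⟨_, rfl⟩
  obtain ⟨V, hV⟩ : ∃ V : ℝ, V = 4 * (l + 1) * (l + 2) := ⟨_, rfl⟩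
  -- After the substitution `n = l + 1 + j`, all the polynomials in `l` and `j` below have
  -- nonnegative coefficients.
  have hD0 : 0 < D := by
    rw [hD, hn]; push_cast; ring_nf; positivity
  have hW0 : 0 < W := by rw [hW]; positivity
  have hV0 : 0 < V := by rw [hV]; positivity
  have hP : 0 < V * T * (R - 2 * (n + 1) * T) - W * (2 * (n + 2) * T - E * D) * (G - T) := by
    rw [hV, hW, hE, hG, hD, hR, hT, hn]; push_cast; ring_nf; positivity
  have hQ : 0 ≤ V * (R - 4 * (n + 1) * T) + W * (2 * (n + 2) * T - E * D)
      - W * (2 * (n + 2)) * (G - T) := by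
    rw [hV, hW, hE, hG, hD, hR, hT, hn]; push_cast; ring_nf; positivity
  have hS : 0 ≤ W * (2 * (n + 2)) - 2 * (n + 1) * V := by
    rw [hV, hW, hn]; push_cast; ring_nf; positivity
  rw [← hT, ← hD, ← sub_nonneg] at hr
  have hform := quadratic_form_pos hP hQ hS ha hr
  have hc : (n + l + 2) * W * c = R * a - 2 * (n + 1) * (D * b) := by
    rw [hW, hR, hD]; linear_combination h3
  have he' : 2 * (n + l + 2) * e = 2 * (n + 2) * b - E * a := by
    rw [hE]; linear_combination -he
  have hf' : V * f = 2 * (G * a - D * b) := by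
    rw [hV, hG, hD]; linear_combination 2 * hf
  rw [← sub_pos]
  refine pos_of_mul_pos_right (a := (n + l + 2) * W * V * D) ?_ (by positivity)
  linear_combination hform - V * D * b * hc + W * D / 2 * (V * f) * he'
    + W * D / 2 * (2 * (n + 2) * b - E * a) * hf'

theorem mainTheorem4 (l m : ℕ) (hl : 1 ≤ l) (hm : l + 1 ≤ m) :
    borosMoll l m ^ 2 > borosMoll l (m - 1) * borosMoll l (m + 1) ∧
      borosMoll l (m - 1) * borosMoll l (m + 1) > borosMoll (l - 1) m * borosMoll (l + 1) m := by
  obtain ⟨k, rfl⟩ : ∃ k, l = k + 1 := ⟨l - 1, by omega⟩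
  obtain ⟨j, rfl⟩ : ∃ j, m = k + 1 + j + 1 := ⟨m - (k + 2), by omega⟩
  exact ⟨borosMoll_sq_gt k j rfl, borosMoll_mul_gt k j rfl⟩
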